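/- Let $\lambda>0$, let $w_\lambda(x)=|x|^{2\lambda}e^{-x^2}$ on $\mathbb R$, and let $\mathcal P_n$ be the set of real polynomials of degree at most $n$. With $\|p\|=\left(\int_{\mathbb R}|p(x)|^2w_\lambda(x)\,dx\right)^{1/2}$, let $$M_n=\sup_{0\ne p\in\mathcal P_n}\frac{\|p'\|}{\|p\|}$$ be the Bernstein–Markov factor of $\frac{d}{dx}$ in $L_2(w_\lambda)$, and call a nonzero $p\in\mathcal P_n$ extremal if $\|p'\|/\|p\|=M_n$. Put $d_{2s}=\Gamma(s+\lambda+\tfrac12)$ for $s=0,1,2,\dots$. Then $M_n$ is finite for every $n$, and the following holds. (i) If $n$ is even, then $M_n=\sqrt{2n}$, and the extremal polynomials are exactly $cH_n^\lambda$ with $c\neq0$, where $H_n^\lambda$ is the generalized Hermite polynomial, $H_{2m}^\lambda(x)=(-1)^m2^{2m}m!\,L_m^{\lambda-1/2}(x^2)$, and $L_m^\kappa(x)=\sum_{k=0}^m\frac{(-1)^k}{k!}\binom{m+\kappa}{m-k}x^k$ is the generalized Laguerre polynomial. (ii) If $n$ is odd, then the polynomial $$F_{\frac{n+1}2}(t)=\det\Big(\big\{(2j+1)(2j+2\lambda)d_{2i+2j}+(t-4j-2)d_{2i+2j+2}\big\}_{i,j=0}^{\frac{n-1}2}\Big)$$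 has a largest positive root $\nu$, and $M_n=\sqrt{\nu}$. The extremal polynomials are odd; they are exactly the nonzero polynomials $p(x)=\sum_{j=0}^{(n-1)/2}a_{2j+1}x^{2j+1}$ whose real coefficients satisfy $$\sum_{j=0}^{\frac{n-1}2}\big\{(2j+1)(2j+2\lambda)d_{2i+2j}+(\nu-4j-2)d_{2i+2j+2}\big\}a_{2j+1}=0,\qquad i=0,\dots,\tfrac{n-1}2.$$ -/

import Mathlib

open Polynomial

noncomputable section

namespace HermiteMarkov

/-- The norm `‖p‖ = (∫ |p(x)|² w(x) dx)^{1/2}` of a real polynomial in `L₂(w)`, for a weight `w`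
on the real line. -/
def l2Norm (w : ℝ → ℝ) (p : ℝ[X]) : ℝ :=
  √(∫ x : ℝ, |p.eval x| ^ 2 * w x)

/-- The set of quotients `‖p'‖ / ‖p‖`, for `p` a nonzero real polynomial of degree at most `n`. -/
def markovQuotients (w : ℝ → ℝ) (n : ℕ) : Set ℝ :=
  {r | ∃ p : ℝ[X], p ≠ 0 ∧ p.natDegree ≤ n ∧ r = l2Norm w (derivative p) / l2Norm w p}

/-- The Bernstein-Markov factor `M_n(L₂(w), d/dx)`. -/
def markovFactor (w : ℝ → ℝ) (n : ℕ) : ℝ :=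
  sSup (markovQuotients w n)

/-- `p` is an extremal polynomial: it attains the supremum in the Bernstein-Markov factor. -/
def IsExtremal (w : ℝ → ℝ) (n : ℕ) (p : ℝ[X]) : Prop :=
  p ≠ 0 ∧ p.natDegree ≤ n ∧ l2Norm w (derivative p) / l2Norm w p = markovFactor w n

/-- The generalized Hermite weight `w_λ(x) = |x|^{2λ} e^{-x²}`. -/
def hermiteWeight (lam : ℝ) (x : ℝ) : ℝ :=
  |x| ^ (2 * lam) * Real.exp (-x ^ 2)

/-- All the integrals that enter the Bernstein-Markov factor for `w_λ` converge. -/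
theorem integrable_sq_mul_hermiteWeight {lam : ℝ} (hlam : 0 < lam) (p : ℝ[X]) :
    MeasureTheory.Integrable (fun x : ℝ => |p.eval x| ^ 2 * hermiteWeight lam x) := by
  have key : ∀ k : ℕ, MeasureTheory.Integrable (fun x : ℝ => x ^ k * hermiteWeight lam x) := by
    intro k
    have h := (integrable_rpow_mul_exp_neg_mul_sq (b := 1) one_pos (s := k + 2 * lam)
      (by have := Nat.cast_nonneg (α := ℝ) k; linarith)).norm
    have h2 := h.add (MeasureTheory.Integrable.comp_neg h)
    refine MeasureTheory.Integrable.mono' h2 ?_ ?_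
    · unfold hermiteWeight
      exact Measurable.aestronglyMeasurable (by fun_prop)
    · refine Filter.Eventually.of_forall fun x => ?_
      have hx : ‖x ^ k * hermiteWeight lam x‖
          = |x| ^ ((k : ℝ) + 2 * lam) * Real.exp (-1 * x ^ 2) := by
        unfold hermiteWeight
        rw [Real.norm_eq_abs, abs_mul, abs_pow, abs_mul, Real.abs_exp,
          abs_of_nonneg (Real.rpow_nonneg (abs_nonneg x) _),
          Real.rpow_add_of_nonneg (abs_nonneg x) (Nat.cast_nonneg k) (by linarith),
          Real.rpow_natCast, mul_assoc]
        simp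
      rw [hx]
      simp only [Pi.add_apply, norm_mul, Real.norm_eq_abs, Real.abs_exp, neg_sq]
      rcases le_total 0 x with h0 | h0
      · have h1 : |x ^ ((k : ℝ) + 2 * lam)| = |x| ^ ((k : ℝ) + 2 * lam) := by
          rw [abs_of_nonneg h0, abs_of_nonneg (Real.rpow_nonneg h0 _)]
        rw [h1]
        have : 0 ≤ |(-x) ^ ((k : ℝ) + 2 * lam)| * Real.exp (-1 * x ^ 2) := by positivity
        linarith
      · have h1 : |(-x) ^ ((k : ℝ) + 2 * lam)| = |x| ^ ((k : ℝ) + 2 * lam) := by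
          rw [abs_of_nonpos h0, abs_of_nonneg (Real.rpow_nonneg (by linarith) _)]
        rw [h1]
        have : 0 ≤ |x ^ ((k : ℝ) + 2 * lam)| * Real.exp (-1 * x ^ 2) := by positivity
        linarith
  have hsum : (fun x : ℝ => |p.eval x| ^ 2 * hermiteWeight lam x)
      = fun x : ℝ => ∑ k ∈ Finset.range ((p ^ 2).natDegree + 1),
          (p ^ 2).coeff k * (x ^ k * hermiteWeight lam x) := by
    funext x
    rw [sq_abs, ← eval_pow, eval_eq_sum_range, Finset.sum_mul]
    exact Finset.sum_congr rfl fun k _ => by ring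
  rw [hsum]
  exact MeasureTheory.integrable_finsetSum _ fun k _ => (key k).const_mul _

/-- The generalized Laguerre polynomial
`L_n^κ(x) = ∑_{k ≤ n} (-1)^k binom(n+κ, n-k) x^k / k!`. -/
def laguerre (n : ℕ) (κ : ℝ) : ℝ[X] :=
  ∑ k ∈ Finset.range (n + 1),
    C ((-1) ^ k * (∏ i ∈ Finset.range (n - k), ((n : ℝ) + κ - i)) /
      (((n - k).factorial : ℝ) * (k.factorial : ℝ))) * X ^ k

/-- Rodrigues' formula: `L_n^κ(x) = (1/n!) x^{-κ} e^x (d/dx)^n (x^{n+κ} e^{-x})` for `x > 0`. -/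
theorem laguerre_rodrigues (n : ℕ) (κ x : ℝ) (hx : 0 < x) :
    (laguerre n κ).eval x =
      1 / (n.factorial : ℝ) * x ^ (-κ) * Real.exp x *
        iteratedDeriv n (fun y : ℝ => y ^ ((n : ℝ) + κ) * Real.exp (-y)) x := by
  have h1 : ContDiffAt ℝ n (fun y : ℝ => y ^ ((n : ℝ) + κ)) x :=
    Real.contDiffAt_rpow_const_of_ne hx.ne'
  have h2 : ContDiffAt ℝ n (fun y : ℝ => Real.exp (-y)) x :=
    (Real.contDiff_exp.comp contDiff_neg).contDiffAt
  have hm : iteratedDeriv n (fun y : ℝ => y ^ ((n : ℝ) + κ) * Real.exp (-y)) x = _ :=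
    iteratedDeriv_mul h1 h2
  rw [hm, ← Finset.sum_range_reflect, Finset.mul_sum, laguerre, eval_finsetSum]
  refine Finset.sum_congr rfl fun k hk => ?_
  have hk' : k ≤ n := Nat.lt_succ_iff.mp (Finset.mem_range.mp hk)
  have e1 : n + 1 - 1 - k = n - k := by omega
  have e2 : n - (n - k) = k := by omega
  rw [e1, e2, iteratedDeriv_eq_iterate, Real.iter_deriv_rpow_const, iteratedDeriv_comp_neg,
    iteratedDeriv_eq_iterate, Real.iter_deriv_exp, descPochhammer_eval_eq_prod_range,
    Nat.choose_symm hk', Nat.cast_choose ℝ hk']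
  have e3 : (n : ℝ) + κ - ((n - k : ℕ) : ℝ) = κ + k := by
    rw [Nat.cast_sub hk']; ring
  rw [e3, Real.rpow_add hx, Real.rpow_natCast, Real.rpow_neg hx.le, Real.exp_neg]
  have hκ : x ^ κ ≠ 0 := (Real.rpow_pos_of_pos hx κ).ne'
  simp only [eval_mul, eval_C, eval_pow, eval_X, smul_eq_mul]
  have f1 : ((n - k).factorial : ℝ) ≠ 0 := by positivity
  have f2 : (k.factorial : ℝ) ≠ 0 := by positivity
  have f3 : (n.factorial : ℝ) ≠ 0 := by positivity
  field_simp

/-- The generalized Hermite polynomial `H_n^λ`: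
`H_{2m}^λ(x) = (-1)^m 2^{2m} m! L_m^{λ-1/2}(x²)` and
`H_{2m+1}^λ(x) = (-1)^m 2^{2m+1} m! x L_m^{λ+1/2}(x²)`. -/
def genHermite (lam : ℝ) (n : ℕ) : ℝ[X] :=
  if Even n then
    C ((-1) ^ (n / 2) * 2 ^ n * ((n / 2).factorial : ℝ)) *
      (laguerre (n / 2) (lam - 1 / 2)).comp (X ^ 2)
  else
    C ((-1) ^ (n / 2) * 2 ^ n * ((n / 2).factorial : ℝ)) *
      (X * (laguerre (n / 2) (lam + 1 / 2)).comp (X ^ 2))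

/-- `evenMoment lam s` is `d_{2s} = Γ(s + λ + 1/2)`. -/
def evenMoment (lam : ℝ) (s : ℕ) : ℝ :=
  Real.Gamma (s + lam + 1 / 2)

/-- The polynomial `(2j+1)(2j+2λ) d_{2i+2j} + (t - 4j - 2) d_{2i+2j+2}` in the variable `t`. -/
def oddEntry (lam : ℝ) (i j : ℕ) : ℝ[X] :=
  C ((2 * (j : ℝ) + 1) * (2 * (j : ℝ) + 2 * lam) * evenMoment lam (i + j)) +
    (X - C (4 * (j : ℝ) + 2)) * C (evenMoment lam (i + j + 1))

/-- The polynomial `F_k(t)`: the determinant of the `k × k` matrix with entries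
`(2j+1)(2j+2λ) d_{2i+2j} + (t - 4j - 2) d_{2i+2j+2}`, `0 ≤ i, j ≤ k - 1`. -/
def oddDet (lam : ℝ) (k : ℕ) : ℝ[X] :=
  Matrix.det (Matrix.of fun i j : Fin k => oddEntry lam i j)

end HermiteMarkov

end

open HermiteMarkov

/-!
Write a polynomial as `p(x) = e(x²) + x o(x²)`. The two summands are orthogonal in `L₂(w_lam)`, as
are their derivatives, so `‖p'‖²` and `‖p‖²` split into quadratic forms in `e` and in `o`
(`l2Norm_sq_expand_add`, `l2Norm_sq_derivative_expand_add`). All integrals reduce to the functional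
`moment lam : X ^ s ↦ Γ(s + lam + 1/2)`, whose recurrence is integration by parts
(`moment_X_mul_derivative`).

For the even part, `‖p'‖²` is four times the Dirichlet form of the Laguerre operator with parameter
`lam - 1/2`. Its largest eigenvalue on polynomials `e` of degree at most `m` is `m`, with eigenvector
the Laguerre polynomial (`moment_X_mul_derivative_sq_le_and_eq`). This gives the sharp constant
`4m = 2(2m)`.

For the odd part, `‖p'‖² = (4D(o) + 2‖o‖²) - 2 lam ∫ o(x²)² w_lam`, where `‖o‖` and the Dirichlet form
`D` belong to the weight `w_(lam+1)` (`moment_sq_add_two_X_mul_derivative`). Dropping the last term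
bounds the quotient by `4m + 2` for `o` of degree at most `m`. Hence for even degree the odd part
never competes. Conversely, testing with the Laguerre polynomial of parameter `lam + 1/2` gives the
quotient `4m + 1/(lam + 1/2)`, so for odd degree `2m + 1` the odd part strictly beats the even one
(`lt_moment_laguerre_sq_add`).

On the coefficients of `o` the two forms are given by `oddDerivGram` and `oddGram`, and the matrix of
the theorem is `t • oddGram - oddDerivGram`. The maximal quotient of the pencil is its largest
eigenvalue, attained exactly on the kernel (`exists_isGreatest_det_smul_sub`).
-/

noncomputable section

namespace HermiteMarkov

/-! ### The moment functional -/

/-- The linear functional on `ℝ[X]` sending `X ^ s` to `Γ(s + lam + 1/2)`, that is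
`q ↦ ∫ q(x²) w_lam(x) dx`. It is defined through its values on monomials so that identities between
moments stay algebraic; `integral_expand_mul_hermiteWeight` is the integral formula. -/
def moment (lam : ℝ) : ℝ[X] →ₗ[ℝ] ℝ :=
  lsum fun s => evenMoment lam s • LinearMap.id

@[simp]
theorem moment_monomial (lam : ℝ) (s : ℕ) (a : ℝ) :
    moment lam (monomial s a) = evenMoment lam s * a := by
  simp [moment, lsum_apply]

@[simp]
theorem moment_X_pow (lam : ℝ) (s : ℕ) : moment lam (X ^ s) = evenMoment lam s := by
  rw [X_pow_eq_monomial, moment_monomial, mul_one]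

theorem moment_C_mul (lam a : ℝ) (q : ℝ[X]) : moment lam (C a * q) = a * moment lam q := by
  rw [← smul_eq_C_mul, map_smul, smul_eq_mul]

theorem evenMoment_add_one (lam : ℝ) (s : ℕ) : evenMoment (lam + 1) s = evenMoment lam (s + 1) := by
  unfold evenMoment
  push_cast
  congr 1
  ring

theorem evenMoment_succ {lam : ℝ} (hlam : 0 < lam) (s : ℕ) :
    evenMoment lam (s + 1) = (s + lam + 1 / 2) * evenMoment lam s := by
  unfold evenMoment
  rw [← Real.Gamma_add_one (by positivity)]
  push_cast
  congr 1
  ring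

theorem moment_add_one (lam : ℝ) (q : ℝ[X]) : moment (lam + 1) q = moment lam (X * q) := by
  induction q using Polynomial.induction_on' with
  | add p q hp hq => rw [mul_add, map_add, map_add, hp, hq]
  | monomial s a => rw [X_mul_monomial, moment_monomial, moment_monomial, evenMoment_add_one]

/-- Integration by parts for the functional `moment lam`; on monomials it is the functional equation
of `Γ`. -/
theorem moment_X_mul_derivative {lam : ℝ} (hlam : 0 < lam) (f : ℝ[X]) :
    moment lam (X * derivative f) = moment lam (X * f) - (lam + 1 / 2) * moment lam f := by
  induction f using Polynomial.induction_on' with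
  | add p q hp hq => simp only [map_add, mul_add, hp, hq]; ring
  | monomial s a =>
    rw [derivative_monomial, X_mul_monomial, X_mul_monomial]
    rcases s with _ | s
    · simp only [moment_monomial, evenMoment_succ hlam]
      simp [mul_assoc]
    · rw [Nat.add_sub_cancel]
      simp only [moment_monomial, evenMoment_succ hlam]
      push_cast
      ring

theorem integrable_eval_mul_hermiteWeight {lam : ℝ} (hlam : 0 < lam) (f : ℝ[X]) :
    MeasureTheory.Integrable (fun x : ℝ => f.eval x * hermiteWeight lam x) := by
  -- polarization reduces the claim to squares of polynomials
  have h := ((integrable_sq_mul_hermiteWeight hlam (f + 1)).sub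
    (integrable_sq_mul_hermiteWeight hlam (f - 1))).const_mul (1 / 4)
  refine h.congr (Filter.Eventually.of_forall fun x => ?_)
  simp only [Pi.sub_apply, sq_abs, eval_add, eval_sub, eval_one]
  ring

theorem hermiteWeight_neg (lam x : ℝ) : hermiteWeight lam (-x) = hermiteWeight lam x := by
  simp [hermiteWeight]

theorem hermiteWeight_nonneg (lam x : ℝ) : 0 ≤ hermiteWeight lam x := by
  unfold hermiteWeight
  positivity

theorem continuous_hermiteWeight {lam : ℝ} (hlam : 0 < lam) : Continuous (hermiteWeight lam) := by
  unfold hermiteWeight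
  exact (continuous_abs.rpow_const fun _ => Or.inr (by positivity)).mul (by fun_prop)

theorem integral_pow_mul_hermiteWeight {lam : ℝ} (hlam : 0 < lam) (s : ℕ) :
    ∫ x : ℝ, (x ^ 2) ^ s * hermiteWeight lam x = evenMoment lam s := by
  have h := integral_comp_abs (f := fun x : ℝ => x ^ (2 * (s : ℝ) + 2 * lam) * Real.exp (-x ^ (2 : ℝ)))
  have h0 : (0 : ℝ) ≤ s := s.cast_nonneg
  rw [integral_rpow_mul_exp_neg_rpow two_pos (by linarith)] at h
  calc _ = _ := MeasureTheory.integral_congr_ae (Filter.Eventually.of_forall fun x => ?_)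
    _ = _ := h
    _ = _ := ?_
  · simp only [hermiteWeight]
    rw [Real.rpow_add_of_nonneg (abs_nonneg x) (by positivity) (by positivity),
      Real.rpow_mul (abs_nonneg x) 2 (s : ℝ), Real.rpow_natCast, Real.rpow_two, sq_abs, mul_assoc]
  · unfold evenMoment
    rw [← mul_assoc]
    norm_num
    congr 1
    ring

theorem integral_expand_mul_hermiteWeight {lam : ℝ} (hlam : 0 < lam) (q : ℝ[X]) :
    ∫ x : ℝ, (expand ℝ 2 q).eval x * hermiteWeight lam x = moment lam q := by
  induction q using Polynomial.induction_on' with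
  | add p q hp hq =>
    rw [map_add, map_add, ← hp, ← hq, ← MeasureTheory.integral_add
      (integrable_eval_mul_hermiteWeight hlam _) (integrable_eval_mul_hermiteWeight hlam _)]
    simp only [eval_add, add_mul]
  | monomial s a =>
    rw [moment_monomial, mul_comm, ← integral_pow_mul_hermiteWeight hlam,
      ← MeasureTheory.integral_const_mul]
    simp only [expand_eval, eval_monomial, mul_assoc]

theorem integral_X_mul_expand_mul_hermiteWeight (lam : ℝ) (q : ℝ[X]) :
    ∫ x : ℝ, (X * expand ℝ 2 q).eval x * hermiteWeight lam x = 0 := by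
  have h := MeasureTheory.integral_neg_eq_self
    (fun x : ℝ => (X * expand ℝ 2 q).eval x * hermiteWeight lam x) MeasureTheory.volume
  have h' : (fun x : ℝ => (X * expand ℝ 2 q).eval (-x) * hermiteWeight lam (-x))
      = fun x => -((X * expand ℝ 2 q).eval x * hermiteWeight lam x) := by
    funext x
    simp only [eval_mul, eval_X, expand_eval, neg_sq, hermiteWeight_neg]
    ring
  rw [h', MeasureTheory.integral_neg] at h
  linarith

theorem l2Norm_sq (lam : ℝ) (p : ℝ[X]) :
    l2Norm (hermiteWeight lam) p ^ 2 = ∫ x : ℝ, |p.eval x| ^ 2 * hermiteWeight lam x :=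
  Real.sq_sqrt (MeasureTheory.integral_nonneg fun x =>
    mul_nonneg (by positivity) (hermiteWeight_nonneg lam x))

theorem l2Norm_pos {lam : ℝ} (hlam : 0 < lam) {p : ℝ[X]} (hp : p ≠ 0) :
    0 < l2Norm (hermiteWeight lam) p := by
  -- `X * p` has a non-root: there `p` and the weight are both nonzero
  obtain ⟨x, hx⟩ : ∃ x, (X * p).eval x ≠ 0 := by
    by_contra! h
    exact mul_ne_zero X_ne_zero hp (Polynomial.funext fun x => by simpa using h x)
  rw [eval_mul, eval_X] at hx
  refine Real.sqrt_pos.2 (MeasureTheory.integral_pos_of_integrable_nonneg_nonzero (x := x) ?_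
    (integrable_sq_mul_hermiteWeight hlam p) ?_ ?_)
  · exact (p.continuous.abs.pow 2).mul (continuous_hermiteWeight hlam)
  · exact fun x => mul_nonneg (by positivity) (hermiteWeight_nonneg lam x)
  · have h1 := abs_pos.2 (left_ne_zero_of_mul hx)
    have h2 := abs_pos.2 (right_ne_zero_of_mul hx)
    unfold hermiteWeight
    positivity

/-- The even and odd parts of a polynomial are orthogonal, and multiplying an odd part by `x²`
turns `w_lam` into `w_(lam+1)`. -/
theorem l2Norm_sq_expand_add {lam : ℝ} (hlam : 0 < lam) (e o : ℝ[X]) :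
    l2Norm (hermiteWeight lam) (expand ℝ 2 e + X * expand ℝ 2 o) ^ 2
      = moment lam (e ^ 2) + moment (lam + 1) (o ^ 2) := by
  have h : ∀ x : ℝ, |(expand ℝ 2 e + X * expand ℝ 2 o).eval x| ^ 2 * hermiteWeight lam x
      = (expand ℝ 2 (e ^ 2 + X * o ^ 2)).eval x * hermiteWeight lam x
        + (X * expand ℝ 2 (2 * e * o)).eval x * hermiteWeight lam x := by
    intro x
    rw [sq_abs]
    simp only [map_add, map_mul, map_pow, expand_X, eval_add, eval_mul, eval_pow, eval_X,
      expand_eval, map_ofNat, eval_ofNat]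
    ring
  rw [l2Norm_sq]
  simp only [h]
  rw [MeasureTheory.integral_add (integrable_eval_mul_hermiteWeight hlam _)
    (integrable_eval_mul_hermiteWeight hlam _), integral_X_mul_expand_mul_hermiteWeight, add_zero,
    integral_expand_mul_hermiteWeight hlam, map_add, moment_add_one]

theorem l2Norm_sq_derivative_expand_add {lam : ℝ} (hlam : 0 < lam) (e o : ℝ[X]) :
    l2Norm (hermiteWeight lam) (derivative (expand ℝ 2 e + X * expand ℝ 2 o)) ^ 2
      = 4 * moment lam (X * derivative e ^ 2) + moment lam ((o + 2 * X * derivative o) ^ 2) := by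
  have h : derivative (expand ℝ 2 e + X * expand ℝ 2 o)
      = expand ℝ 2 (o + 2 * X * derivative o) + X * expand ℝ 2 (C 2 * derivative e) := by
    simp only [derivative_mul, derivative_X, derivative_expand, map_add, map_mul,
      expand_X, map_ofNat, Nat.cast_ofNat]
    ring
  rw [h, l2Norm_sq_expand_add hlam, moment_add_one, add_comm, mul_pow, ← C_pow, mul_left_comm,
    moment_C_mul]
  norm_num

theorem moment_sq_pos {lam : ℝ} (hlam : 0 < lam) {q : ℝ[X]} (hq : q ≠ 0) :
    0 < moment lam (q ^ 2) := by
  have h := l2Norm_sq_expand_add hlam q 0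
  rw [map_zero, mul_zero, add_zero, zero_pow two_ne_zero, map_zero, add_zero] at h
  rw [← h]
  exact pow_pos (l2Norm_pos hlam ((expand_ne_zero two_pos).2 hq)) 2

theorem moment_sq_nonneg {lam : ℝ} (hlam : 0 < lam) (q : ℝ[X]) : 0 ≤ moment lam (q ^ 2) := by
  rcases eq_or_ne q 0 with rfl | hq
  · simp
  · exact (moment_sq_pos hlam hq).le

theorem exists_eq_expand_add (p : ℝ[X]) :
    ∃ e o : ℝ[X], p = expand ℝ 2 e + X * expand ℝ 2 o := by
  refine ⟨contract 2 p, contract 2 p.divX, ?_⟩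
  ext k
  rcases Nat.even_or_odd' k with ⟨m, rfl | rfl⟩
  · rw [coeff_add, coeff_expand_mul' two_pos, coeff_contract two_ne_zero, mul_comm m]
    rcases m with _ | m
    · simp
    · rw [show 2 * (m + 1) = 2 * m + 1 + 1 by ring, coeff_X_mul, coeff_expand two_pos,
        if_neg (by omega), add_zero]
  · rw [coeff_add, coeff_X_mul, coeff_expand_mul' two_pos, coeff_contract two_ne_zero,
      coeff_expand two_pos, if_neg (by omega), zero_add, coeff_divX, mul_comm m]

theorem natDegree_le_of_expand_add {e o : ℝ[X]} {n : ℕ}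
    (h : (expand ℝ 2 e + X * expand ℝ 2 o).natDegree ≤ n) :
    2 * e.natDegree ≤ n ∧ (o ≠ 0 → 2 * o.natDegree + 1 ≤ n) := by
  have he : ∀ m, (expand ℝ 2 e + X * expand ℝ 2 o).coeff (2 * m) = e.coeff m := by
    intro m
    rw [coeff_add, coeff_expand_mul' two_pos]
    rcases m with _ | m
    · simp
    · rw [show 2 * (m + 1) = 2 * m + 1 + 1 by ring, coeff_X_mul, coeff_expand two_pos,
        if_neg (by omega), add_zero]
  have ho : ∀ m, (expand ℝ 2 e + X * expand ℝ 2 o).coeff (2 * m + 1) = o.coeff m := by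
    intro m
    rw [coeff_add, coeff_X_mul, coeff_expand_mul' two_pos, coeff_expand two_pos,
      if_neg (by omega), zero_add]
  constructor
  · rcases eq_or_ne e 0 with rfl | h0
    · simp
    · exact (le_natDegree_of_ne_zero (by rwa [he, coeff_natDegree, leadingCoeff_ne_zero])).trans h
  · intro h0
    exact (le_natDegree_of_ne_zero (by rwa [ho, coeff_natDegree, leadingCoeff_ne_zero])).trans h

theorem natDegree_expand_add_le {e o : ℝ[X]} {n : ℕ} (he : 2 * e.natDegree ≤ n)
    (ho : o = 0 ∨ 2 * o.natDegree + 1 ≤ n) :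
    (expand ℝ 2 e + X * expand ℝ 2 o).natDegree ≤ n := by
  refine natDegree_add_le_of_degree_le (by rw [natDegree_expand]; omega) ?_
  rcases ho with rfl | ho
  · simp
  · exact natDegree_mul_le.trans (by rw [natDegree_expand, natDegree_X]; omega)

/-! ### Laguerre polynomials -/

/-- The Laguerre operator `q ↦ -x q'' - (lam + 1/2 - x) q'`, with parameter `κ = lam - 1/2`. -/
def laguerreOp (lam : ℝ) (q : ℝ[X]) : ℝ[X] :=
  X * derivative q - (X * derivative (derivative q) + C (lam + 1 / 2) * derivative q)

theorem moment_laguerreOp_mul {lam : ℝ} (hlam : 0 < lam) (q r : ℝ[X]) :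
    moment lam (laguerreOp lam q * r) = moment lam (X * (derivative q * derivative r)) := by
  have h := moment_X_mul_derivative hlam (derivative q * r)
  rw [derivative_mul, mul_add, map_add] at h
  have h' : laguerreOp lam q * r = X * (derivative q * r) - X * (derivative (derivative q) * r)
      - C (lam + 1 / 2) * (derivative q * r) := by
    unfold laguerreOp
    ring
  rw [h', map_sub, map_sub, moment_C_mul]
  linarith

theorem coeff_laguerreOp (lam : ℝ) (q : ℝ[X]) (k : ℕ) :
    (laguerreOp lam q).coeff k = k * q.coeff k - (k + 1) * (k + lam + 1 / 2) * q.coeff (k + 1) := by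
  unfold laguerreOp
  rcases k with _ | k
  · simp [coeff_derivative]
  · simp only [coeff_sub, coeff_add, coeff_X_mul, coeff_C_mul, coeff_derivative]
    push_cast
    ring

theorem coeff_laguerre (n : ℕ) (κ : ℝ) (k : ℕ) :
    (laguerre n κ).coeff k = if k ≤ n then
      (-1) ^ k * (∏ i ∈ Finset.range (n - k), ((n : ℝ) + κ - i)) /
        (((n - k).factorial : ℝ) * (k.factorial : ℝ)) else 0 := by
  unfold laguerre
  simp [finsetSum_coeff, coeff_C_mul, coeff_X_pow]

theorem natDegree_laguerre_le (n : ℕ) (κ : ℝ) : (laguerre n κ).natDegree ≤ n :=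
  natDegree_le_iff_coeff_eq_zero.2 fun k hk => by rw [coeff_laguerre, if_neg (not_le.2 hk)]

theorem coeff_laguerre_self_ne_zero (n : ℕ) (κ : ℝ) : (laguerre n κ).coeff n ≠ 0 := by
  rw [coeff_laguerre, if_pos le_rfl, Nat.sub_self, Finset.prod_range_zero]
  positivity

theorem laguerre_ne_zero (n : ℕ) (κ : ℝ) : laguerre n κ ≠ 0 := fun h =>
  coeff_laguerre_self_ne_zero n κ (by rw [h, coeff_zero])

theorem laguerreOp_laguerre (lam : ℝ) (n : ℕ) :
    laguerreOp lam (laguerre n (lam - 1 / 2)) = C (n : ℝ) * laguerre n (lam - 1 / 2) := by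
  ext k
  rw [coeff_laguerreOp, coeff_C_mul, coeff_laguerre, coeff_laguerre]
  rcases lt_trichotomy k n with h | rfl | h
  · obtain ⟨d, rfl⟩ := Nat.exists_eq_add_of_lt h
    rw [if_pos (by omega), if_pos (by omega), show k + d + 1 - k = d + 1 by omega,
      show k + d + 1 - (k + 1) = d by omega, Finset.prod_range_succ, Nat.factorial_succ d,
      Nat.factorial_succ k]
    have h1 : (d.factorial : ℝ) ≠ 0 := by positivity
    have h2 : (k.factorial : ℝ) ≠ 0 := by positivity
    have h3 : (d : ℝ) + 1 ≠ 0 := by positivity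
    have h4 : (k : ℝ) + 1 ≠ 0 := by positivity
    push_cast
    field_simp
    ring
  · rw [if_neg (show ¬k + 1 ≤ k by omega), mul_zero, sub_zero]
  · rw [if_neg (by omega), if_neg (by omega)]
    simp

theorem moment_laguerre_mul_of_natDegree_lt {lam : ℝ} (hlam : 0 < lam) (n : ℕ) {r : ℝ[X]}
    (hr : r.natDegree < n) : moment lam (laguerre n (lam - 1 / 2) * r) = 0 := by
  -- the self-adjoint operator `laguerreOp` is triangular with distinct diagonal entries
  have key : ∀ j < n, moment lam (laguerre n (lam - 1 / 2) * X ^ j) = 0 := by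
    intro j
    induction j with
    | zero =>
      intro hn
      have h := moment_laguerreOp_mul hlam (laguerre n (lam - 1 / 2)) 1
      rw [laguerreOp_laguerre, derivative_one, mul_zero, mul_zero, map_zero, mul_assoc,
        moment_C_mul] at h
      rw [pow_zero]
      exact (mul_eq_zero.1 h).resolve_left (by positivity)
    | succ j ih =>
      intro hn
      have h1 := moment_laguerreOp_mul hlam (laguerre n (lam - 1 / 2)) (X ^ (j + 1))
      have h2 := moment_laguerreOp_mul hlam (X ^ (j + 1)) (laguerre n (lam - 1 / 2))
      have h3 : laguerreOp lam (X ^ (j + 1)) = C ((j : ℝ) + 1) * X ^ (j + 1)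
          - C (((j : ℝ) + 1) * (j + lam + 1 / 2)) * X ^ j := by
        ext k
        rw [coeff_laguerreOp, coeff_sub, coeff_C_mul, coeff_C_mul]
        simp only [coeff_X_pow]
        rcases eq_or_ne k (j + 1) with rfl | hk
        · simp
        · rcases eq_or_ne k j with rfl | hk'
          · simp
          · rw [if_neg hk, if_neg (by omega), if_neg hk']
            simp
      rw [laguerreOp_laguerre, mul_assoc, moment_C_mul] at h1
      rw [h3, sub_mul, map_sub, mul_assoc, mul_assoc, moment_C_mul, moment_C_mul,
        mul_comm (X ^ j), ih (by omega), mul_comm (X ^ (j + 1)),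
        mul_comm (derivative (X ^ (j + 1) : ℝ[X])), ← h1] at h2
      have hlt : ((j : ℝ) + 1) < n := by exact_mod_cast hn
      have h4 : ((j : ℝ) + 1 - n) * moment lam (laguerre n (lam - 1 / 2) * X ^ (j + 1)) = 0 := by
        linarith
      exact (mul_eq_zero.1 h4).resolve_left (by linarith)
  rw [r.as_sum_range_C_mul_X_pow, Finset.mul_sum, map_sum]
  refine Finset.sum_eq_zero fun j hj => ?_
  rw [mul_left_comm, moment_C_mul, key j (by have := Finset.mem_range.1 hj; omega), mul_zero]

theorem moment_X_mul_derivative_laguerre_mul {lam : ℝ} (hlam : 0 < lam) (n : ℕ) (r : ℝ[X]) :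
    moment lam (X * (derivative (laguerre n (lam - 1 / 2)) * derivative r))
      = n * moment lam (laguerre n (lam - 1 / 2) * r) := by
  rw [← moment_laguerreOp_mul hlam, laguerreOp_laguerre, mul_assoc, moment_C_mul]

theorem exists_eq_C_mul_laguerre_add (κ : ℝ) {n : ℕ} {q : ℝ[X]} (hq : q.natDegree ≤ n + 1) :
    ∃ (c : ℝ) (r : ℝ[X]), r.natDegree ≤ n ∧ q = C c * laguerre (n + 1) κ + r := by
  have h0 := coeff_laguerre_self_ne_zero (n + 1) κ
  set a := (laguerre (n + 1) κ).coeff (n + 1)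
  refine ⟨q.coeff (n + 1) / a, q - C (q.coeff (n + 1) / a) * laguerre (n + 1) κ, ?_, by ring⟩
  refine natDegree_le_iff_coeff_eq_zero.2 fun k hk => ?_
  rw [coeff_sub, coeff_C_mul]
  rcases eq_or_lt_of_le (Nat.succ_le_of_lt hk) with h | h
  · rw [← h]
    simp only [Nat.succ_eq_add_one]
    rw [div_mul_cancel₀ _ h0, sub_self]
  · rw [coeff_eq_zero_of_natDegree_lt (hq.trans_lt h), coeff_laguerre, if_neg (not_le.2 h)]
    simp

/-- The Dirichlet form of the Laguerre operator has largest eigenvalue `n` on polynomials of degree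
at most `n`, and the eigenspace is spanned by the Laguerre polynomial. The remainder after removing
the Laguerre component is orthogonal to it and has smaller degree. -/
theorem moment_X_mul_derivative_sq_le_and_eq {lam : ℝ} (hlam : 0 < lam) {n : ℕ} {q : ℝ[X]}
    (hq : q.natDegree ≤ n) :
    moment lam (X * derivative q ^ 2) ≤ n * moment lam (q ^ 2) ∧
    (moment lam (X * derivative q ^ 2) = n * moment lam (q ^ 2) →
      ∃ c : ℝ, q = C c * laguerre n (lam - 1 / 2)) := by
  induction n generalizing q with
  | zero =>
    obtain ⟨a, rfl⟩ := natDegree_eq_zero.1 (Nat.le_zero.1 hq)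
    refine ⟨by simp, fun _ => ⟨a, ?_⟩⟩
    simp [laguerre]
  | succ n ih =>
    obtain ⟨c, r, hr, rfl⟩ := exists_eq_C_mul_laguerre_add (lam - 1 / 2) hq
    set l := laguerre (n + 1) (lam - 1 / 2) with hl
    have h0 : moment lam (l * r) = 0 := moment_laguerre_mul_of_natDegree_lt hlam _ (by omega)
    have h1 := moment_X_mul_derivative_laguerre_mul hlam (n + 1) l
    have h2 := moment_X_mul_derivative_laguerre_mul hlam (n + 1) r
    rw [← hl] at h1 h2
    have h3 : moment lam ((C c * l + r) ^ 2) = c ^ 2 * moment lam (l * l) + moment lam (r ^ 2) := by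
      have : (C c * l + r) ^ 2 = C (c ^ 2) * (l * l) + C (2 * c) * (l * r) + r ^ 2 := by
        simp only [C_mul, C_pow, map_ofNat]
        ring
      rw [this, map_add, map_add, moment_C_mul, moment_C_mul, h0, mul_zero, add_zero]
    have h4 : moment lam (X * derivative (C c * l + r) ^ 2)
        = ((n + 1 : ℕ) : ℝ) * (c ^ 2 * moment lam (l * l)) + moment lam (X * derivative r ^ 2) := by
      have : X * derivative (C c * l + r) ^ 2 = C (c ^ 2) * (X * (derivative l * derivative l))
          + C (2 * c) * (X * (derivative l * derivative r)) + X * derivative r ^ 2 := by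
        simp only [C_mul, C_pow, map_ofNat, derivative_add, derivative_mul, derivative_C]
        ring
      rw [this, map_add, map_add, moment_C_mul, moment_C_mul, h1, h2, h0]
      ring
    obtain ⟨hle, -⟩ := ih hr
    have hr0 := moment_sq_nonneg hlam r
    rw [h3, h4]
    push_cast
    refine ⟨by linarith, fun h => ⟨c, ?_⟩⟩
    have : r = 0 := by
      by_contra hne
      linarith [moment_sq_pos hlam hne]
    rw [this, add_zero]

/-! ### The odd part -/

/-- The quadratic form `‖p'‖²` of the odd polynomial `p(x) = x o(x²)`, written with the Dirichlet form
of the Laguerre operator for the weight `w_(lam+1)`. -/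
theorem moment_sq_add_two_X_mul_derivative {lam : ℝ} (hlam : 0 < lam) (o : ℝ[X]) :
    moment lam ((o + 2 * X * derivative o) ^ 2)
      = 4 * moment (lam + 1) (X * derivative o ^ 2) + 2 * moment (lam + 1) (o ^ 2)
        - 2 * lam * moment lam (o ^ 2) := by
  have h := moment_X_mul_derivative hlam (o ^ 2)
  have h1 : (o + 2 * X * derivative o) ^ 2 = o ^ 2 + C 2 * (X * derivative (o ^ 2))
      + C 4 * (X * (X * derivative o ^ 2)) := by
    simp only [sq, derivative_mul, map_ofNat]
    ring
  rw [h1, map_add, map_add, moment_C_mul, moment_C_mul, h, moment_add_one, moment_add_one]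
  ring

theorem moment_sq_add_two_X_mul_derivative_le {lam : ℝ} (hlam : 0 < lam) {m : ℕ} {o : ℝ[X]}
    (ho : o.natDegree ≤ m) :
    moment lam ((o + 2 * X * derivative o) ^ 2) ≤ (4 * m + 2) * moment (lam + 1) (o ^ 2) := by
  rw [moment_sq_add_two_X_mul_derivative hlam]
  have h1 := (moment_X_mul_derivative_sq_le_and_eq (lam := lam + 1) (by positivity) ho).1
  have h2 := mul_nonneg hlam.le (moment_sq_nonneg hlam o)
  linarith

/-- The odd generalized Hermite polynomial `x o(x²)` of degree `2m + 1` has Rayleigh quotient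
`4m + 1/(lam + 1/2)`, which exceeds the largest quotient `4m` of the even polynomials of degree at
most `2m`. -/
theorem lt_moment_laguerre_sq_add {lam : ℝ} (hlam : 0 < lam) (m : ℕ) :
    4 * m * moment (lam + 1) (laguerre m (lam + 1 / 2) ^ 2)
      < moment lam ((laguerre m (lam + 1 / 2)
          + 2 * X * derivative (laguerre m (lam + 1 / 2))) ^ 2) := by
  have hlam' : 0 < lam + 1 := by positivity
  have hκ : lam + 1 / 2 = lam + 1 - 1 / 2 := by ring
  rw [moment_sq_add_two_X_mul_derivative hlam]
  set l := laguerre m (lam + 1 / 2) with hl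
  have hpos : 0 < moment lam (l ^ 2) := moment_sq_pos hlam (laguerre_ne_zero _ _)
  have h1 : moment (lam + 1) (X * derivative l ^ 2) = m * moment (lam + 1) (l ^ 2) := by
    have := moment_X_mul_derivative_laguerre_mul hlam' m l
    rwa [← hκ, ← hl, ← sq, ← sq] at this
  have h2 : moment (lam + 1) (l * derivative l) = 0 := by
    rcases m with _ | m
    · simp [hl, laguerre]
    · rw [hl, hκ]
      refine moment_laguerre_mul_of_natDegree_lt hlam' _ ((natDegree_derivative_le _).trans_lt ?_)
      have := natDegree_laguerre_le (m + 1) (lam + 1 - 1 / 2)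
      omega
  have h3 := moment_X_mul_derivative hlam (l ^ 2)
  rw [← moment_add_one, ← moment_add_one] at h3
  have h4 : derivative (l ^ 2) = C 2 * (l * derivative l) := by
    simp only [sq, derivative_mul, map_ofNat]
    ring
  rw [h4, moment_C_mul, h2] at h3
  rw [h1]
  linarith

/-! ### The largest eigenvalue of a pencil of symmetric matrices -/

open Matrix in
/-- Variational characterization of the largest root `ν` of `det (t G - A)`, for `A` symmetric and `G`
positive definite: `ν` is the maximum of the Rayleigh quotient, which is attained exactly on the
kernel of `ν G - A`. -/
theorem exists_isGreatest_det_smul_sub {ι : Type*} [Fintype ι] [DecidableEq ι] [Nonempty ι]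
    {A G : Matrix ι ι ℝ} (hA : A.IsSymm) (hG : G.IsSymm)
    (hpos : ∀ v : ι → ℝ, v ≠ 0 → 0 < v ⬝ᵥ G *ᵥ v) :
    ∃ ν : ℝ, IsGreatest {t : ℝ | (t • G - A).det = 0} ν ∧
      (∀ v, v ⬝ᵥ A *ᵥ v ≤ ν * (v ⬝ᵥ G *ᵥ v)) ∧
      ∀ v, v ⬝ᵥ A *ᵥ v = ν * (v ⬝ᵥ G *ᵥ v) ↔ (ν • G - A) *ᵥ v = 0 := by
  have hcont : ∀ M : Matrix ι ι ℝ, Continuous fun v : ι → ℝ => v ⬝ᵥ M *ᵥ v := fun M => by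
    simp only [dotProduct, mulVec]
    fun_prop
  have hform : ∀ (t : ℝ) (v : ι → ℝ),
      v ⬝ᵥ (t • G - A) *ᵥ v = t * (v ⬝ᵥ G *ᵥ v) - v ⬝ᵥ A *ᵥ v := fun t v => by
    rw [sub_mulVec, smul_mulVec, dotProduct_sub, dotProduct_smul, smul_eq_mul]
  have hhom : ∀ (M : Matrix ι ι ℝ) (c : ℝ) (v : ι → ℝ),
      (c • v) ⬝ᵥ M *ᵥ (c • v) = c ^ 2 * (v ⬝ᵥ M *ᵥ v) := fun M c v => by
    rw [mulVec_smul, dotProduct_smul, smul_dotProduct, smul_eq_mul, smul_eq_mul]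
    ring
  obtain ⟨u, hu, hmax⟩ := (isCompact_sphere (0 : ι → ℝ) 1).exists_isMaxOn
    (NormedSpace.sphere_nonempty.2 zero_le_one)
    (f := fun v => (v ⬝ᵥ A *ᵥ v) / (v ⬝ᵥ G *ᵥ v))
    ((hcont A).continuousOn.div (hcont G).continuousOn fun v hv =>
      (hpos v (ne_zero_of_mem_unit_sphere ⟨v, hv⟩)).ne')
  have hu0 : u ≠ 0 := ne_zero_of_mem_unit_sphere ⟨u, hu⟩
  set ν := (u ⬝ᵥ A *ᵥ u) / (u ⬝ᵥ G *ᵥ u) with hν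
  have hle : ∀ v, v ⬝ᵥ A *ᵥ v ≤ ν * (v ⬝ᵥ G *ᵥ v) := by
    intro v
    rcases eq_or_ne v 0 with rfl | hv
    · simp
    · have hn : ‖v‖ ≠ 0 := norm_ne_zero_iff.2 hv
      have hs : ‖v‖⁻¹ • v ∈ Metric.sphere (0 : ι → ℝ) 1 := by
        simp [norm_smul, hn]
      have h := hmax hs
      simp only [Set.mem_ofPred_eq, hhom] at h
      rw [mul_div_mul_left _ _ (by positivity)] at h
      exact (div_le_iff₀ (hpos v hv)).1 h
  have hpsd : (ν • G - A).PosSemidef := by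
    refine PosSemidef.of_dotProduct_mulVec_nonneg ?_ fun v => ?_
    · rw [IsHermitian, conjTranspose_eq_transpose_of_trivial]
      exact (hG.smul ν).sub hA
    · rw [star_trivial, hform]
      linarith [hle v]
  have heq : ∀ v, v ⬝ᵥ A *ᵥ v = ν * (v ⬝ᵥ G *ᵥ v) ↔ (ν • G - A) *ᵥ v = 0 := by
    intro v
    rw [← hpsd.dotProduct_mulVec_zero_iff, star_trivial, hform, sub_eq_zero, eq_comm]
  refine ⟨ν, ⟨?_, ?_⟩, hle, heq⟩
  · refine exists_mulVec_eq_zero_iff.1 ⟨u, hu0, (heq u).1 ?_⟩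
    rw [hν, div_mul_cancel₀ _ (hpos u hu0).ne']
  · intro t ht
    obtain ⟨v, hv, h⟩ := exists_mulVec_eq_zero_iff.2 ht
    have h1 := hform t v
    rw [h, dotProduct_zero] at h1
    exact le_of_mul_le_mul_right (by linarith [hle v]) (hpos v hv)

/-! ### The matrix pencil of the odd polynomials -/

/-- The polynomial `o` with coefficients `a`. The odd polynomial with coefficients `a` is then
`x o(x²)`. -/
def ofCoeffs {k : ℕ} (a : Fin k → ℝ) : ℝ[X] :=
  ∑ j : Fin k, C (a j) * X ^ (j : ℕ)

theorem coeff_ofCoeffs {k : ℕ} (a : Fin k → ℝ) (j : Fin k) : (ofCoeffs a).coeff j = a j := by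
  simp [ofCoeffs, finsetSum_coeff, coeff_X_pow, Fin.val_inj]

theorem ofCoeffs_ne_zero {k : ℕ} {a : Fin k → ℝ} (ha : a ≠ 0) : ofCoeffs a ≠ 0 := fun h =>
  ha (funext fun j => by rw [← coeff_ofCoeffs a j, h]; simp)

theorem natDegree_ofCoeffs_le {m : ℕ} (a : Fin (m + 1) → ℝ) : (ofCoeffs a).natDegree ≤ m :=
  natDegree_sum_le_of_forall_le _ _ fun j _ =>
    (natDegree_C_mul_X_pow_le _ _).trans (Nat.lt_succ_iff.1 j.2)

theorem ofCoeffs_coeff {m : ℕ} {o : ℝ[X]} (ho : o.natDegree ≤ m) :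
    ofCoeffs (fun j : Fin (m + 1) => o.coeff j) = o := by
  unfold ofCoeffs
  rw [Fin.sum_univ_eq_sum_range fun j => C (o.coeff j) * X ^ j]
  exact (o.as_sum_range_C_mul_X_pow' (Nat.lt_succ_iff.2 ho)).symm

theorem X_mul_expand_ofCoeffs {k : ℕ} (a : Fin k → ℝ) :
    X * expand ℝ 2 (ofCoeffs a) = ∑ j : Fin k, C (a j) * X ^ (2 * (j : ℕ) + 1) := by
  simp only [ofCoeffs, map_sum, Finset.mul_sum, map_mul, expand_C, map_pow, expand_X]
  exact Finset.sum_congr rfl fun j _ => by ring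

/-- Gram matrix of the odd monomials `x ^ (2j+1)`. -/
def oddGram (lam : ℝ) (k : ℕ) : Matrix (Fin k) (Fin k) ℝ :=
  Matrix.of fun i j => evenMoment lam (i + j + 1)

/-- Gram matrix of the derivatives of the odd monomials `x ^ (2j+1)`. -/
def oddDerivGram (lam : ℝ) (k : ℕ) : Matrix (Fin k) (Fin k) ℝ :=
  Matrix.of fun i j => (2 * (i : ℝ) + 1) * (2 * j + 1) * evenMoment lam (i + j)

theorem eval_oddEntry {lam : ℝ} (hlam : 0 < lam) {k : ℕ} (t : ℝ) (i j : Fin k) :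
    (oddEntry lam i j).eval t = (t • oddGram lam k - oddDerivGram lam k) i j := by
  simp only [oddEntry, eval_add, eval_mul, eval_sub, eval_C, eval_X, oddGram, oddDerivGram,
    Matrix.sub_apply, Matrix.smul_apply, Matrix.of_apply, smul_eq_mul, evenMoment_succ hlam]
  push_cast
  ring

theorem eval_oddDet {lam : ℝ} (hlam : 0 < lam) (k : ℕ) (t : ℝ) :
    (oddDet lam k).eval t = (t • oddGram lam k - oddDerivGram lam k).det := by
  rw [oddDet, ← coe_evalRingHom, RingHom.map_det]
  congr 1
  ext i j
  rw [← eval_oddEntry hlam]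
  simp

theorem isSymm_oddGram (lam : ℝ) (k : ℕ) : (oddGram lam k).IsSymm := by
  ext i j
  simp [oddGram, add_comm]

theorem isSymm_oddDerivGram (lam : ℝ) (k : ℕ) : (oddDerivGram lam k).IsSymm := by
  ext i j
  simp [oddDerivGram, add_comm, mul_comm]

open Matrix in
theorem dotProduct_oddGram_mulVec (lam : ℝ) {k : ℕ} (a : Fin k → ℝ) :
    a ⬝ᵥ oddGram lam k *ᵥ a = moment (lam + 1) (ofCoeffs a ^ 2) := by
  have h : ofCoeffs a ^ 2 = ∑ i : Fin k, ∑ j : Fin k, C (a i * a j) * X ^ ((i : ℕ) + j) := by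
    rw [sq, ofCoeffs, Finset.sum_mul_sum]
    refine Finset.sum_congr rfl fun i _ => Finset.sum_congr rfl fun j _ => ?_
    rw [C_mul]
    ring
  simp only [h, map_sum, moment_C_mul, moment_X_pow, dotProduct, mulVec, Finset.mul_sum, oddGram,
    of_apply, evenMoment_add_one]
  exact Finset.sum_congr rfl fun i _ => Finset.sum_congr rfl fun j _ => by ring

open Matrix in
theorem dotProduct_oddDerivGram_mulVec (lam : ℝ) {k : ℕ} (a : Fin k → ℝ) :
    a ⬝ᵥ oddDerivGram lam k *ᵥ a
      = moment lam ((ofCoeffs a + 2 * X * derivative (ofCoeffs a)) ^ 2) := by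
  have h0 : ofCoeffs a + 2 * X * derivative (ofCoeffs a)
      = ∑ j : Fin k, C ((2 * (j : ℝ) + 1) * a j) * X ^ (j : ℕ) := by
    simp only [ofCoeffs, derivative_sum, Finset.mul_sum, ← Finset.sum_add_distrib]
    refine Finset.sum_congr rfl fun j _ => ?_
    rcases hj : (j : ℕ) with _ | i
    · simp
    · simp only [derivative_C_mul_X_pow, Nat.add_sub_cancel, C_mul, C_add, map_ofNat, map_one,
        Nat.cast_add, Nat.cast_one]
      ring
  have h : (ofCoeffs a + 2 * X * derivative (ofCoeffs a)) ^ 2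
      = ∑ i : Fin k, ∑ j : Fin k,
        C (((2 * (i : ℝ) + 1) * a i) * ((2 * (j : ℝ) + 1) * a j)) * X ^ ((i : ℕ) + j) := by
    rw [h0, sq, Finset.sum_mul_sum]
    refine Finset.sum_congr rfl fun i _ => Finset.sum_congr rfl fun j _ => ?_
    rw [C_mul (a := (2 * (i : ℝ) + 1) * a i)]
    ring
  simp only [h, map_sum, moment_C_mul, moment_X_pow, dotProduct, mulVec, Finset.mul_sum,
    oddDerivGram, of_apply]
  exact Finset.sum_congr rfl fun i _ => Finset.sum_congr rfl fun j _ => by ring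

/-! ### Extremal polynomials -/

/-- A sharp inequality `‖p'‖² ≤ Λ ‖p‖²` determines the Bernstein-Markov factor, and the extremal
polynomials are its equality cases. -/
theorem markovFactor_eq_sqrt {lam : ℝ} (hlam : 0 < lam) {n : ℕ} {Λ : ℝ} (hΛ : 0 ≤ Λ)
    (hle : ∀ p : ℝ[X], p.natDegree ≤ n → l2Norm (hermiteWeight lam) (derivative p) ^ 2
      ≤ Λ * l2Norm (hermiteWeight lam) p ^ 2)
    {p₀ : ℝ[X]} (h0 : p₀ ≠ 0) (hn : p₀.natDegree ≤ n)
    (heq : l2Norm (hermiteWeight lam) (derivative p₀) ^ 2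
      = Λ * l2Norm (hermiteWeight lam) p₀ ^ 2) :
    BddAbove (markovQuotients (hermiteWeight lam) n) ∧
    markovFactor (hermiteWeight lam) n = √Λ ∧
    ∀ p : ℝ[X], IsExtremal (hermiteWeight lam) n p ↔ p ≠ 0 ∧ p.natDegree ≤ n ∧
      l2Norm (hermiteWeight lam) (derivative p) ^ 2 = Λ * l2Norm (hermiteWeight lam) p ^ 2 := by
  have hiff : ∀ p : ℝ[X], p ≠ 0 →
      (l2Norm (hermiteWeight lam) (derivative p) / l2Norm (hermiteWeight lam) p = √Λ ↔
        l2Norm (hermiteWeight lam) (derivative p) ^ 2 = Λ * l2Norm (hermiteWeight lam) p ^ 2) := by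
    intro p hp
    have hN := l2Norm_pos hlam hp
    have hD : 0 ≤ l2Norm (hermiteWeight lam) (derivative p) := Real.sqrt_nonneg _
    rw [eq_comm, Real.sqrt_eq_iff_eq_sq hΛ (by positivity), div_pow, eq_div_iff (by positivity),
      eq_comm]
  have hgr : IsGreatest (markovQuotients (hermiteWeight lam) n) √Λ := by
    refine ⟨⟨p₀, h0, hn, ((hiff p₀ h0).2 heq).symm⟩, ?_⟩
    rintro _ ⟨p, hp, hpn, rfl⟩
    have hN := l2Norm_pos hlam hp
    refine Real.le_sqrt_of_sq_le ?_
    rw [div_pow, div_le_iff₀ (by positivity)]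
    exact hle p hpn
  have hM : markovFactor (hermiteWeight lam) n = √Λ := hgr.csSup_eq
  refine ⟨⟨_, hgr.2⟩, hM, fun p => ?_⟩
  unfold IsExtremal
  rw [hM]
  exact and_congr_right fun hp => and_congr_right fun _ => hiff p hp

theorem genHermite_two_mul (lam : ℝ) (m : ℕ) :
    genHermite lam (2 * m)
      = C ((-1) ^ m * 2 ^ (2 * m) * (m.factorial : ℝ))
        * expand ℝ 2 (laguerre m (lam - 1 / 2)) := by
  rw [genHermite, if_pos (even_two_mul m), Nat.mul_div_cancel_left _ two_pos,
    expand_eq_comp_X_pow]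

theorem markov_even {lam : ℝ} (hlam : 0 < lam) (m : ℕ) :
    BddAbove (markovQuotients (hermiteWeight lam) (2 * m)) ∧
    markovFactor (hermiteWeight lam) (2 * m) = √(2 * ((2 * m : ℕ) : ℝ)) ∧
    ∀ p : ℝ[X], IsExtremal (hermiteWeight lam) (2 * m) p ↔
      ∃ c : ℝ, c ≠ 0 ∧ p = C c * genHermite lam (2 * m) := by
  have hlam' : 0 < lam + 1 := by positivity
  set l := laguerre m (lam - 1 / 2) with hl
  have hodd : ∀ o : ℝ[X], (o ≠ 0 → 2 * o.natDegree + 1 ≤ 2 * m) → o ≠ 0 →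
      moment lam ((o + 2 * X * derivative o) ^ 2) < 4 * m * moment (lam + 1) (o ^ 2) := by
    intro o ho h
    have h1 := moment_sq_add_two_X_mul_derivative_le hlam (le_refl o.natDegree)
    have h2 := moment_sq_pos hlam' h
    have h3 : (o.natDegree : ℝ) + 1 ≤ m := by
      have := ho h
      exact_mod_cast (by omega : o.natDegree + 1 ≤ m)
    nlinarith
  have hmul : ∀ c : ℝ, l2Norm (hermiteWeight lam) (derivative (C c * expand ℝ 2 l)) ^ 2
      = 2 * ((2 * m : ℕ) : ℝ) * l2Norm (hermiteWeight lam) (C c * expand ℝ 2 l) ^ 2 := by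
    intro c
    have h1 : C c * expand ℝ 2 l = expand ℝ 2 (C c * l) + X * expand ℝ 2 0 := by simp
    have h2 := moment_X_mul_derivative_laguerre_mul hlam m l
    rw [← hl] at h2
    have h3 : X * derivative (C c * l) ^ 2 = C (c ^ 2) * (X * (derivative l * derivative l)) := by
      simp only [derivative_mul, derivative_C, C_pow]
      ring
    have h4 : (C c * l) ^ 2 = C (c ^ 2) * (l * l) := by
      rw [C_pow]
      ring
    rw [h1, l2Norm_sq_expand_add hlam, l2Norm_sq_derivative_expand_add hlam, h3, h4, moment_C_mul,
      moment_C_mul, h2]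
    simp
    ring
  have hl0 : expand ℝ 2 l ≠ 0 := (expand_ne_zero two_pos).2 (laguerre_ne_zero _ _)
  have hldeg : ∀ c : ℝ, (C c * expand ℝ 2 l).natDegree ≤ 2 * m := fun c => by
    refine (natDegree_C_mul_le _ _).trans ?_
    rw [natDegree_expand, mul_comm]
    exact Nat.mul_le_mul_left 2 (natDegree_laguerre_le _ _)
  have hall : ∀ p : ℝ[X], p.natDegree ≤ 2 * m → l2Norm (hermiteWeight lam) (derivative p) ^ 2
      ≤ 2 * ((2 * m : ℕ) : ℝ) * l2Norm (hermiteWeight lam) p ^ 2 := by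
    intro p hp
    obtain ⟨e, o, rfl⟩ := exists_eq_expand_add p
    obtain ⟨he, ho⟩ := natDegree_le_of_expand_add hp
    rw [l2Norm_sq_expand_add hlam, l2Norm_sq_derivative_expand_add hlam]
    have h1 := (moment_X_mul_derivative_sq_le_and_eq hlam (n := m) (q := e) (by omega)).1
    push_cast
    rcases eq_or_ne o 0 with rfl | h
    · simp
      linarith
    · linarith [hodd o ho h]
  obtain ⟨hb, hM, hex⟩ := markovFactor_eq_sqrt hlam (n := 2 * m) (Λ := 2 * ((2 * m : ℕ) : ℝ))
    (by positivity) (p₀ := C 1 * expand ℝ 2 l) hall (by simpa using hl0) (hldeg 1)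
    (hmul 1)
  refine ⟨hb, hM, fun p => (hex p).trans ⟨?_, ?_⟩⟩
  · rintro ⟨hp0, hpn, heq⟩
    obtain ⟨e, o, rfl⟩ := exists_eq_expand_add p
    obtain ⟨he, ho⟩ := natDegree_le_of_expand_add hpn
    rw [l2Norm_sq_expand_add hlam, l2Norm_sq_derivative_expand_add hlam] at heq
    push_cast at heq
    obtain ⟨h1, h2⟩ := moment_X_mul_derivative_sq_le_and_eq hlam
      (n := m) (q := e) (by omega)
    have ho0 : o = 0 := by
      by_contra h
      linarith [hodd o ho h]
    subst ho0
    simp only [mul_zero, add_zero, ne_eq, OfNat.ofNat_ne_zero,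
      not_false_eq_true, zero_pow, map_zero] at heq hp0 ⊢
    obtain ⟨c, rfl⟩ := h2 (by linarith)
    set b : ℝ := (-1) ^ m * 2 ^ (2 * m) * (m.factorial : ℝ) with hb'
    have hb0 : b ≠ 0 := by
      have : (m.factorial : ℝ) ≠ 0 := by positivity
      simp [hb', this]
    refine ⟨c / b, div_ne_zero ?_ hb0, ?_⟩
    · rintro rfl
      simp at hp0
    · rw [genHermite_two_mul, ← hb', ← mul_assoc, ← C_mul, div_mul_cancel₀ _ hb0, map_mul,
        expand_C]
  · rintro ⟨c, hc, rfl⟩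
    rw [genHermite_two_mul, ← mul_assoc, ← C_mul]
    refine ⟨mul_ne_zero (C_ne_zero.2 (mul_ne_zero hc ?_)) hl0, hldeg _, hmul _⟩
    have : (m.factorial : ℝ) ≠ 0 := by positivity
    simp [this]

open Matrix in
theorem markov_odd {lam : ℝ} (hlam : 0 < lam) (m : ℕ) :
    BddAbove (markovQuotients (hermiteWeight lam) (2 * m + 1)) ∧
    ∃ ν : ℝ, IsGreatest {t : ℝ | 0 < t ∧ (oddDet lam (m + 1)).IsRoot t} ν ∧
      markovFactor (hermiteWeight lam) (2 * m + 1) = √ν ∧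
      ∀ p : ℝ[X], IsExtremal (hermiteWeight lam) (2 * m + 1) p ↔
        p ≠ 0 ∧ ∃ a : Fin (m + 1) → ℝ,
          p = ∑ j : Fin (m + 1), C (a j) * X ^ (2 * (j : ℕ) + 1) ∧
          ∀ i : Fin (m + 1), ∑ j : Fin (m + 1), (oddEntry lam i j).eval ν * a j = 0 := by
  have hlam' : 0 < lam + 1 := by positivity
  obtain ⟨ν, ⟨hroot, hgreat⟩, hle, heq⟩ := exists_isGreatest_det_smul_sub
    (isSymm_oddDerivGram lam (m + 1)) (isSymm_oddGram lam (m + 1)) (fun a ha => by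
      rw [dotProduct_oddGram_mulVec]
      exact moment_sq_pos hlam' (ofCoeffs_ne_zero ha))
  simp only [dotProduct_oddGram_mulVec, dotProduct_oddDerivGram_mulVec] at hle heq
  have hleo : ∀ o : ℝ[X], o.natDegree ≤ m →
      moment lam ((o + 2 * X * derivative o) ^ 2) ≤ ν * moment (lam + 1) (o ^ 2) := by
    intro o ho
    have := hle fun j => o.coeff j
    rwa [ofCoeffs_coeff ho] at this
  -- the odd extremal value beats the even one
  have hν : 4 * (m : ℝ) < ν := by
    have h1 := lt_moment_laguerre_sq_add hlam m
    have h2 := hleo _ (natDegree_laguerre_le m (lam + 1 / 2))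
    exact lt_of_mul_lt_mul_right (h1.trans_le h2) (moment_sq_nonneg hlam' _)
  have hm : (0 : ℝ) ≤ m := m.cast_nonneg
  have hνpos : 0 < ν := by linarith
  have heven : ∀ e : ℝ[X], e.natDegree ≤ m → 4 * moment lam (X * derivative e ^ 2)
      ≤ ν * moment lam (e ^ 2) ∧
      (4 * moment lam (X * derivative e ^ 2) = ν * moment lam (e ^ 2) → e = 0) := by
    intro e he
    have h1 := (moment_X_mul_derivative_sq_le_and_eq hlam he).1
    have h2 := moment_sq_nonneg hlam e
    refine ⟨by nlinarith, fun h => ?_⟩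
    by_contra h0
    have h3 := moment_sq_pos hlam h0
    nlinarith
  obtain ⟨u, hu, hu0⟩ := exists_mulVec_eq_zero_iff.2 hroot
  have hext : ∀ a : Fin (m + 1) → ℝ, (ν • oddGram lam (m + 1) - oddDerivGram lam (m + 1)) *ᵥ a = 0 →
      (X * expand ℝ 2 (ofCoeffs a)).natDegree ≤ 2 * m + 1 ∧
      l2Norm (hermiteWeight lam) (derivative (X * expand ℝ 2 (ofCoeffs a))) ^ 2
        = ν * l2Norm (hermiteWeight lam) (X * expand ℝ 2 (ofCoeffs a)) ^ 2 := by
    intro a ha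
    have h1 : X * expand ℝ 2 (ofCoeffs a) = expand ℝ 2 0 + X * expand ℝ 2 (ofCoeffs a) := by simp
    have h2 := natDegree_ofCoeffs_le a
    refine ⟨?_, ?_⟩
    · rw [h1]
      exact natDegree_expand_add_le (by simp) (Or.inr (by omega))
    · rw [h1, l2Norm_sq_expand_add hlam, l2Norm_sq_derivative_expand_add hlam, (heq a).2 ha]
      simp
  have hall : ∀ p : ℝ[X], p.natDegree ≤ 2 * m + 1 →
      l2Norm (hermiteWeight lam) (derivative p) ^ 2
        ≤ ν * l2Norm (hermiteWeight lam) p ^ 2 := by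
    intro p hp
    obtain ⟨e, o, rfl⟩ := exists_eq_expand_add p
    obtain ⟨he, ho⟩ := natDegree_le_of_expand_add hp
    have ho' : o.natDegree ≤ m := by
      rcases eq_or_ne o 0 with rfl | h
      · simp
      · have := ho h
        omega
    rw [l2Norm_sq_expand_add hlam, l2Norm_sq_derivative_expand_add hlam]
    linarith [(heven e (by omega)).1, hleo o ho']
  obtain ⟨hb, hM, hex⟩ := markovFactor_eq_sqrt hlam (n := 2 * m + 1) hνpos.le
    (p₀ := X * expand ℝ 2 (ofCoeffs u)) hall
    (mul_ne_zero X_ne_zero ((expand_ne_zero two_pos).2 (ofCoeffs_ne_zero hu)))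
    (hext u hu0).1 (hext u hu0).2
  refine ⟨hb, ν, ⟨⟨hνpos, ?_⟩, ?_⟩, hM, fun p => (hex p).trans (and_congr_right fun hp0 => ?_)⟩
  · rw [IsRoot, eval_oddDet hlam]
    exact hroot
  · rintro t ⟨-, ht⟩
    rw [IsRoot, eval_oddDet hlam] at ht
    exact hgreat ht
  have hsys : ∀ a : Fin (m + 1) → ℝ,
      (ν • oddGram lam (m + 1) - oddDerivGram lam (m + 1)) *ᵥ a = 0 ↔
      ∀ i : Fin (m + 1), ∑ j : Fin (m + 1), (oddEntry lam i j).eval ν * a j = 0 := by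
    intro a
    simp only [eval_oddEntry hlam, funext_iff, mulVec, dotProduct, Pi.zero_apply]
  constructor
  · rintro ⟨hpn, h⟩
    obtain ⟨e, o, rfl⟩ := exists_eq_expand_add p
    obtain ⟨he, ho⟩ := natDegree_le_of_expand_add hpn
    have ho' : o.natDegree ≤ m := by
      rcases eq_or_ne o 0 with rfl | h
      · simp
      · have := ho h
        omega
    rw [l2Norm_sq_expand_add hlam, l2Norm_sq_derivative_expand_add hlam] at h
    have h1 := heven e (by omega)
    have h2 := hleo o ho'
    obtain rfl := h1.2 (by linarith)
    rw [← ofCoeffs_coeff ho'] at h ⊢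
    refine ⟨fun j => o.coeff j, ?_, (hsys _).1 ((heq _).1 ?_)⟩
    · rw [map_zero, zero_add, X_mul_expand_ofCoeffs]
    · simpa using h
  · rintro ⟨a, rfl, ha⟩
    rw [← X_mul_expand_ofCoeffs]
    exact hext a ((hsys a).2 ha)

end HermiteMarkov

end

open HermiteMarkov
theorem theorem1 (lam : ℝ) (hlam : 0 < lam) (n : ℕ) :
    BddAbove (markovQuotients (hermiteWeight lam) n) ∧
    (Even n →
      markovFactor (hermiteWeight lam) n = √(2 * (n : ℝ)) ∧
      ∀ p : ℝ[X], IsExtremal (hermiteWeight lam) n p ↔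
        ∃ c : ℝ, c ≠ 0 ∧ p = C c * genHermite lam n) ∧
    (Odd n →
      ∃ ν : ℝ, IsGreatest {t : ℝ | 0 < t ∧ (oddDet lam ((n + 1) / 2)).IsRoot t} ν ∧
        markovFactor (hermiteWeight lam) n = √ν ∧
        ∀ p : ℝ[X], IsExtremal (hermiteWeight lam) n p ↔
          p ≠ 0 ∧ ∃ a : Fin ((n + 1) / 2) → ℝ,
            p = ∑ j : Fin ((n + 1) / 2), C (a j) * X ^ (2 * (j : ℕ) + 1) ∧
            ∀ i : Fin ((n + 1) / 2),
              ∑ j : Fin ((n + 1) / 2), (oddEntry lam i j).eval ν * a j = 0) := by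
  rcases Nat.even_or_odd' n with ⟨m, rfl | rfl⟩
  · obtain ⟨hb, h⟩ := markov_even hlam m
    exact ⟨hb, fun _ => h, fun hn => absurd (even_two_mul m) (Nat.not_even_iff_odd.2 hn)⟩
  · obtain ⟨hb, h⟩ := markov_odd hlam m
    refine ⟨hb, fun hn => absurd (odd_two_mul_add_one m) (Nat.not_odd_iff_even.2 hn), fun _ => ?_⟩
    rw [show (2 * m + 1 + 1) / 2 = m + 1 by omega]
    exact h
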